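/- Let $L$ be a countable relational language and let $L^+ = L\cup\{\equiv\}$, where $\equiv$ is a new binary relation symbol. For a countable language $L'$, let $S_{L'}$ be the space of $L'$-structures with underlying set $\mathbb N$, with the Borel $\sigma$-algebra generated by the sets $\{\mathcal S : R^{\mathcal S}(n_1,\dots,n_j)\}$, for $R\in L'$ a relation symbol and $n_1,\dots,n_j\in\mathbb N$ (and analogously for function and constant symbols, if there are any). A countably infinite $L'$-structure $\mathcal M$ \emph{admits an invariant measure} if there is a probability measure $\mu$ on $S_{L'}$ with $\mu(g\cdot X)=\mu(X)$ for every permutation $g$ of $\mathbb N$ and every Borel $X\subseteq S_{L'}$, where $g\cdot\mathcal S$ is the image of the structure $\mathcal S$ under $g$, and with $\mu(\{\mathcal S\in S_{L'} : \mathcal S\cong\mathcal M\})=1$. (1) Let $\mathcal N$ be a countably infinite $L^+$-structure in which $\equiv$ is interpreted as an equivalence relation none of whose classes has exactly one element, and suppose that $\equiv$ respects $L$ in $\mathcal N$: for each $k$-ary relation symbol $R\in L$, if $x_i\equiv y_i$ for $1\le i\le k$, then $R(x_1,\dots,x_k)\leftrightarrow R(y_1,\dots,y_k)$. Then every $\equiv$-class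 of $\mathcal N$ is infinite if and only if $\mathcal N$ admits an invariant measure. (2) Let $\mathcal M$ be a countably infinite $L$-structure with underlying set $M$. For a cardinal $n$ with $1\le n\le\aleph_0$, let $\mathcal M^+_n$ be the $L^+$-structure with underlying set $M\times n$ in which $(a,j)\equiv(a',j')$ if and only if $a=a'$, and in which $R((a_1,j_1),\dots,(a_k,j_k))$ holds if and only if $\mathcal M\models R(a_1,\dots,a_k)$, for every $k$-ary $R\in L$. Then $\mathcal M^+_{\aleph_0}$ admits an invariant measure, while for $1<n<\aleph_0$ the structure $\mathcal M^+_n$ does not admit an invariant measure. -/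

import Mathlib

universe u v w

namespace InvariantMeasure

/-! ### The space of structures on the natural numbers and the logic action -/

/-- The `σ`-algebra on the set `S_L` of `L`-structures with underlying set `ℕ`, generated by the
sets `{S | R^S(n₁, …, nⱼ)}` and `{S | f^S(n₁, …, nₖ) = ℓ}` (constants are `0`-ary functions).
For a countable language it is the Borel `σ`-algebra of the usual topology on `S_L`. -/
instance structureMeasurableSpace (L : FirstOrder.Language.{u, v}) :
    MeasurableSpace (L.Structure ℕ) :=
  MeasurableSpace.generateFrom
    ({X | ∃ (j : ℕ) (R : L.Relations j) (x : Fin j → ℕ),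
        X = {S : L.Structure ℕ | S.RelMap R x}} ∪
     {X | ∃ (k : ℕ) (f : L.Functions k) (x : Fin k → ℕ) (l : ℕ),
        X = {S : L.Structure ℕ | S.funMap f x = l}})

/-- The logic action of the permutations of `ℕ` on `S_L`: the structure `g · S` is the transport
of `S` along `g`, so that `g` is an isomorphism from `S` to `g · S`. -/
@[reducible]
def logicAction {L : FirstOrder.Language.{u, v}} (g : Equiv.Perm ℕ) (S : L.Structure ℕ) :
    L.Structure ℕ where
  funMap := fun f x => g (S.funMap f (g.symm ∘ x))
  RelMap := fun R x => S.RelMap R (g.symm ∘ x)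

/-- A measure `μ` on `S_L` is invariant if `μ (g · X) = μ X` for every permutation `g` of `ℕ`
and every Borel set `X`. -/
def IsInvariant {L : FirstOrder.Language.{u, v}} (μ : MeasureTheory.Measure (L.Structure ℕ)) : Prop :=
  ∀ (g : Equiv.Perm ℕ) (X : Set (L.Structure ℕ)), MeasurableSet X →
    μ (logicAction g '' X) = μ X

/-- The set of structures on `ℕ` that are isomorphic to `M`. -/
def isoClass (L : FirstOrder.Language.{u, v}) (M : Type w) [SM : L.Structure M] : Set (L.Structure ℕ) :=
  {S | Nonempty (@FirstOrder.Language.Equiv L ℕ M S SM)}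

/-- `M` admits an invariant measure: some invariant probability measure on `S_L` is concentrated
on the isomorphism class of `M`. -/
def AdmitsInvariantMeasure (L : FirstOrder.Language.{u, v}) (M : Type w) [L.Structure M] : Prop :=
  ∃ μ : MeasureTheory.Measure (L.Structure ℕ),
    MeasureTheory.IsProbabilityMeasure μ ∧ IsInvariant μ ∧ μ (isoClass L M) = 1

/-! ### Adding an equivalence relation to a relational language -/

/-- The relation symbols of the language `{≡}`: a single binary symbol. -/
inductive EqvSymbol : ℕ → Type
  | eqv : EqvSymbol 2

/-- The language `{≡}` with a single binary relation symbol. -/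
def eqvLanguage : FirstOrder.Language.{0, 0} := ⟨fun _ => Empty, EqvSymbol⟩

/-- The language `L⁺ = L ∪ {≡}`, where `≡` is a new binary relation symbol. -/
abbrev plus (L : FirstOrder.Language.{u, v}) : FirstOrder.Language.{u, v} := L.sum eqvLanguage

/-- The symbol `≡` of `L⁺`. -/
def eqvSym (L : FirstOrder.Language.{u, v}) : (plus L).Relations 2 := Sum.inr EqvSymbol.eqv

/-- A symbol of `L`, viewed as a symbol of `L⁺`. -/
def oldSym (L : FirstOrder.Language.{u, v}) {k : ℕ} (R : L.Relations k) :
    (plus L).Relations k := Sum.inl R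

/-- The interpretation of `≡` in the `L⁺`-structure `N`. -/
def Eqv (L : FirstOrder.Language.{u, v}) {N : Type w} [(plus L).Structure N] (a b : N) : Prop :=
  FirstOrder.Language.Structure.RelMap (eqvSym L) ![a, b]

/-- The `≡`-class of `a` in the `L⁺`-structure `N`. -/
def eqvClass (L : FirstOrder.Language.{u, v}) {N : Type w} [(plus L).Structure N] (a : N) : Set N :=
  {b | Eqv L a b}

/-- `≡` respects `L` in `N`: replacing the entries of a tuple by `≡`-equivalent ones does not
change which relations of `L` hold of it. -/
def Respects (L : FirstOrder.Language.{u, v}) (N : Type w) [(plus L).Structure N] : Prop :=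
  ∀ (k : ℕ) (R : L.Relations k) (x y : Fin k → N), (∀ i, Eqv L (x i) (y i)) →
    (FirstOrder.Language.Structure.RelMap (oldSym L R) x ↔
      FirstOrder.Language.Structure.RelMap (oldSym L R) y)

/-! ### The blow-up of a structure -/

/-- The underlying set `M × ι` of the blow-up in which each element of `M` is replaced by a class
indexed by `ι`. -/
def BlowUp (M : Type w) (ι : Type) : Type w := M × ι

/-- The blow-up as an `L⁺`-structure: `(a, j) ≡ (a', j')` iff `a = a'`, and a relation of `L`
holds of a tuple of pairs iff it holds in `M` of the tuple of first coordinates. -/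
instance blowUpStructure (L : FirstOrder.Language.{u, v}) [hL : L.IsRelational] (M : Type w) (ι : Type)
    [L.Structure M] : (plus L).Structure (BlowUp M ι) where
  funMap := fun {n} f => Sum.elim (fun f' => (hL n).elim f') (fun f' => Empty.elim f') f
  RelMap := fun {_} R => match R with
    | Sum.inl R => fun x => FirstOrder.Language.Structure.RelMap R (fun i => (x i).1)
    | Sum.inr EqvSymbol.eqv => fun x => (x 0).1 = (x 1).1

end InvariantMeasure

open MeasureTheory Filter

namespace InvariantMeasure

/-! ### The logic action and the symbol `≡` -/

/-! If all classes of `N` are infinite, sample an i.i.d. sequence `X` in `N` from a law charging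
every point, and pull the structure of `N` back along `X`. Invariance is exchangeability of `X`.
Almost surely every point is hit infinitely often, so each pulled-back class is infinite, and
matching classes gives an isomorphism with `N` (`pullback_mem_isoClass`). Conversely, under an
invariant probability measure, a fixed `i` almost surely has no `j ≠ i` in a finite class with it:
by invariance all such `j` are equally likely, yet a finite class contains only finitely many
(`measure_finiteClassEvent`). A single finite class with at least two elements therefore rules out
an invariant measure. Blow-ups are special cases. -/

lemma comp_pair {α β : Type*} (f : α → β) (a b : α) : f ∘ ![a, b] = ![f a, f b] := by
  funext i
  fin_cases i <;> rfl

/-- The equivalence symbol of the structure `S` on `ℕ`. -/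
def eqvOn (L : FirstOrder.Language.{u, v}) (S : (plus L).Structure ℕ) (i j : ℕ) : Prop :=
  S.RelMap (eqvSym L) ![i, j]

lemma measurableSet_eqvOn (L : FirstOrder.Language.{u, v}) (i j : ℕ) :
    MeasurableSet {S : (plus L).Structure ℕ | eqvOn L S i j} :=
  MeasurableSpace.measurableSet_generateFrom (Or.inl ⟨2, eqvSym L, ![i, j], rfl⟩)

lemma eqvOn_logicAction (L : FirstOrder.Language.{u, v}) (g : Equiv.Perm ℕ) (S : (plus L).Structure ℕ)
    (i j : ℕ) : eqvOn L (logicAction g S) i j ↔ eqvOn L S (g.symm i) (g.symm j) := by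
  change S.RelMap (eqvSym L) (g.symm ∘ ![i, j]) ↔ _
  rw [comp_pair]
  rfl

lemma logicAction_logicAction_symm {L : FirstOrder.Language.{u, v}} (g : Equiv.Perm ℕ) (S : L.Structure ℕ) :
    logicAction g (logicAction g.symm S) = S := by
  have h {n : ℕ} (x : Fin n → ℕ) : g.symm.symm ∘ g.symm ∘ x = x :=
    funext fun i => g.apply_symm_apply (x i)
  refine FirstOrder.Language.Structure.ext ?_ ?_
  · funext n f x
    exact (g.apply_symm_apply _).trans (congrArg (S.funMap f) (h x))
  · funext n R x
    exact congrArg (S.RelMap R) (h x)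

lemma image_logicAction {L : FirstOrder.Language.{u, v}} (g : Equiv.Perm ℕ) (X : Set (L.Structure ℕ)) :
    logicAction g '' X = logicAction g.symm ⁻¹' X :=
  Set.image_eq_preimage_of_inverse (fun S => logicAction_logicAction_symm g.symm S)
    (logicAction_logicAction_symm g) |> fun h => congrFun h X

lemma measurable_logicAction {L : FirstOrder.Language.{u, v}} (g : Equiv.Perm ℕ) :
    Measurable (logicAction g : L.Structure ℕ → L.Structure ℕ) := by
  refine measurable_generateFrom ?_
  rintro _ (⟨j, R, x, rfl⟩ | ⟨k, f, x, l, rfl⟩)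
  · exact MeasurableSpace.measurableSet_generateFrom (Or.inl ⟨j, R, g.symm ∘ x, rfl⟩)
  · refine MeasurableSpace.measurableSet_generateFrom
      (Or.inr ⟨k, f, g.symm ∘ x, g.symm l, ?_⟩)
    ext S
    exact g.eq_symm_apply.symm

/-! ### Finite classes are incompatible with an invariant measure -/

/-- The structures in which the `≡`-class of `i` is finite and contains `j`. -/
def finiteClassEvent (L : FirstOrder.Language.{u, v}) (i j : ℕ) : Set ((plus L).Structure ℕ) :=
  {S | {k | eqvOn L S i k}.Finite ∧ eqvOn L S i j}

/-- Finite subsets of `ℕ` are the bounded ones, which needs only countable unions and intersections.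
-/
lemma measurableSet_finiteClassEvent (L : FirstOrder.Language.{u, v}) (i j : ℕ) :
    MeasurableSet (finiteClassEvent L i j) := by
  have h : finiteClassEvent L i j =
      (⋃ n : ℕ, ⋂ k : ℕ, ⋂ (_ : n < k), {S | eqvOn L S i k}ᶜ) ∩ {S | eqvOn L S i j} := by
    ext S
    simp only [finiteClassEvent, Set.finite_iff_bddAbove, bddAbove_def, Set.mem_ofPred_eq,
      Set.mem_inter_iff, Set.mem_iUnion, Set.mem_iInter, Set.mem_compl_iff]
    refine and_congr_left fun _ => exists_congr fun n => forall_congr' fun k => ?_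
    rw [← not_lt]
    tauto
  rw [h]
  exact (MeasurableSet.iUnion fun n => MeasurableSet.iInter fun k => MeasurableSet.iInter fun _ =>
    (measurableSet_eqvOn L i k).compl).inter (measurableSet_eqvOn L i j)

lemma image_finiteClassEvent (L : FirstOrder.Language.{u, v}) (g : Equiv.Perm ℕ) (i j : ℕ) :
    logicAction g '' finiteClassEvent L i j = finiteClassEvent L (g i) (g j) := by
  rw [image_logicAction]
  ext S
  simp only [finiteClassEvent, Set.mem_preimage, Set.mem_ofPred_eq, eqvOn_logicAction,
    Equiv.symm_symm]
  refine and_congr_left fun _ => ?_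
  refine ⟨fun h => ?_, fun h => h.preimage g.injective.injOn (s := {k | eqvOn L S (g i) k})⟩
  have := h.image g
  rwa [show {k | eqvOn L S (g i) (g k)} = g ⁻¹' {k | eqvOn L S (g i) k} from rfl,
    g.image_preimage] at this

/-- If the measures of a sequence of events are eventually at least `c`, and no point lies in
infinitely many of the events, then `c = 0`. -/
lemma measure_eq_zero_of_finite_setOf_mem {α : Type*} [MeasurableSpace α] (μ : Measure α)
    [IsFiniteMeasure μ] (E : ℕ → Set α) (hE : ∀ n, MeasurableSet (E n)) {c : ENNReal} {m : ℕ}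
    (hc : ∀ n, m ≤ n → c ≤ μ (E n)) (hfin : ∀ x, {n | x ∈ E n}.Finite) : c = 0 := by
  -- Continuity from above along the tails, whose intersection is the limsup of the events.
  have hT : Tendsto (fun n => μ (⋃ k, ⋃ (_ : n ≤ k), E k)) atTop
      (nhds (μ (⋂ n : ℕ, ⋃ k, ⋃ (_ : n ≤ k), E k))) := by
    refine tendsto_measure_iInter_atTop (fun n => ?_) ?_ ⟨0, measure_ne_top _ _⟩
    · exact (MeasurableSet.iUnion fun k => MeasurableSet.iUnion fun _ => hE k).nullMeasurableSet
    · intro a b hab x hx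
      simp only [Set.mem_iUnion] at hx ⊢
      obtain ⟨k, hk, hx⟩ := hx
      exact ⟨k, hab.trans hk, hx⟩
  have hempty : (⋂ n : ℕ, ⋃ k, ⋃ (_ : n ≤ k), E k) = ∅ := by
    refine Set.eq_empty_of_forall_notMem fun x hx => ?_
    obtain ⟨b, hb⟩ := (hfin x).bddAbove
    have hx' := Set.mem_iInter.1 hx (b + 1)
    simp only [Set.mem_iUnion] at hx'
    obtain ⟨k, hk, hxk⟩ := hx'
    have := hb hxk
    omega
  rw [hempty, measure_empty] at hT
  refine le_antisymm (ge_of_tendsto hT ?_) zero_le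
  filter_upwards [eventually_ge_atTop m] with n hn
  exact (hc n hn).trans (measure_mono (Set.subset_iUnion₂ (s := fun k (_ : n ≤ k) => E k) n le_rfl))

lemma measure_finiteClassEvent {L : FirstOrder.Language.{u, v}} {μ : Measure ((plus L).Structure ℕ)}
    [IsFiniteMeasure μ] (hμ : IsInvariant μ) {i j : ℕ} (hij : i ≠ j) :
    μ (finiteClassEvent L i j) = 0 := by
  refine measure_eq_zero_of_finite_setOf_mem μ (finiteClassEvent L i)
    (measurableSet_finiteClassEvent L i) (m := i + 1) (fun n hn => ?_) (fun S => ?_)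
  -- Since `n ≥ i + 1`, the swap fixes `i` and carries the event for `j` to the event for `n`.
  · have h := hμ (Equiv.swap j n) _ (measurableSet_finiteClassEvent L i j)
    rw [image_finiteClassEvent, Equiv.swap_apply_left,
      Equiv.swap_apply_of_ne_of_ne hij (by omega)] at h
    exact h.ge
  · by_cases hS : {k | eqvOn L S i k}.Finite
    · exact hS.subset fun n hn => hn.2
    · exact Set.finite_empty.subset fun n hn => hS hn.1

/-- An isomorphism carries `≡` to `≡`. -/
lemma eqvOn_iff_of_equiv {L : FirstOrder.Language.{u, v}} {N : Type w} [SN : (plus L).Structure N]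
    {S : (plus L).Structure ℕ} (e : @FirstOrder.Language.Equiv (plus L) ℕ N S SN) (i j : ℕ) :
    eqvOn L S i j ↔ Eqv L (e.toEquiv i) (e.toEquiv j) := by
  have h := e.map_rel' (eqvSym L) ![i, j]
  exact h.symm.trans (by rw [comp_pair]; rfl)

theorem not_admitsInvariantMeasure_of_finite_eqvClass {L : FirstOrder.Language.{u, v}} {N : Type w}
    [SN : (plus L).Structure N] (hnt : ∀ a : N, (eqvClass L a).Nontrivial)
    {a : N} (ha : (eqvClass L a).Finite) : ¬ AdmitsInvariantMeasure (plus L) N := by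
  rintro ⟨μ, _, hinv, hone⟩
  -- Covering by measurable null events avoids any need for `isoClass` to be measurable.
  have hsub : isoClass (plus L) N ⊆ ⋃ i : ℕ, ⋃ j : ℕ, ⋃ (_ : i ≠ j), finiteClassEvent L i j := by
    rintro S ⟨e⟩
    obtain ⟨b, hb, hba⟩ := (hnt a).exists_ne a
    refine Set.mem_iUnion.2 ⟨e.toEquiv.symm a, Set.mem_iUnion₂.2 ⟨e.toEquiv.symm b, ?_, ?_, ?_⟩⟩
    · exact fun h => hba (e.toEquiv.symm.injective h).symm
    · simp only [eqvOn_iff_of_equiv e, Equiv.apply_symm_apply]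
      exact Set.Finite.preimage (s := eqvClass L a) e.toEquiv.injective.injOn ha
    · rw [eqvOn_iff_of_equiv e]
      simpa only [Equiv.apply_symm_apply] using! hb
  have hzero : μ (⋃ i : ℕ, ⋃ j : ℕ, ⋃ (_ : i ≠ j), finiteClassEvent L i j) = 0 := by
    simp only [measure_iUnion_null_iff]
    exact fun i j hij => measure_finiteClassEvent hinv hij
  have := measure_mono_null hsub hzero
  simp [hone] at this

/-! ### Sampling from a structure with infinite classes -/

/-- The structure on `ℕ` obtained by pulling back the relations of `N` along `X : ℕ → N`. -/
@[reducible]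
def pullback {L : FirstOrder.Language.{u, v}} [hL : L.IsRelational] {N : Type w} [L.Structure N]
    (X : ℕ → N) : L.Structure ℕ where
  funMap := fun {n} f => (hL n).elim f
  RelMap := fun R x => FirstOrder.Language.Structure.RelMap R (X ∘ x)

lemma measurable_pullback {L : FirstOrder.Language.{u, v}} [hL : L.IsRelational] {N : Type w} [L.Structure N]
    [Countable N] [MeasurableSpace N] [MeasurableSingletonClass N] :
    Measurable (pullback : (ℕ → N) → L.Structure ℕ) := by
  refine measurable_generateFrom ?_
  rintro _ (⟨j, R, x, rfl⟩ | ⟨k, f, _⟩)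
  · have hm : Measurable fun X : ℕ → N => X ∘ x :=
      measurable_pi_lambda _ fun i => measurable_pi_apply (x i)
    -- `Fin j → N` is countable, so each of its subsets is measurable.
    exact hm (Set.to_countable {y : Fin j → N | FirstOrder.Language.Structure.RelMap R y}).measurableSet
  · exact (hL k).elim f

lemma logicAction_pullback {L : FirstOrder.Language.{u, v}} [hL : L.IsRelational] {N : Type w}
    [L.Structure N] (g : Equiv.Perm ℕ) (X : ℕ → N) :
    logicAction g (pullback X : L.Structure ℕ) = pullback (X ∘ g.symm) := by
  refine FirstOrder.Language.Structure.ext ?_ ?_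
  · funext n f
    exact (hL n).elim f
  · rfl

/-- Two maps between countable types, all of whose fibres are infinite, differ by a bijection. -/
lemma exists_equiv_of_infinite_fibres {α β γ : Type*} [Countable α] [Countable β] (p : α → γ)
    (q : β → γ) (hp : ∀ c, Infinite {a // p a = c}) (hq : ∀ c, Infinite {b // q b = c}) :
    ∃ e : α ≃ β, ∀ a, q (e a) = p a := by
  -- Both fibres are countably infinite.
  have h (c : γ) : Nonempty ({a // p a = c} ≃ {b // q b = c}) := inferInstance
  refine ⟨(Equiv.sigmaFiberEquiv p).symm.trans ((Equiv.sigmaCongrRight fun c => (h c).some).trans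
    (Equiv.sigmaFiberEquiv q)), fun a => ?_⟩
  exact ((h (p a)).some ⟨a, rfl⟩).2

/-- `X` is far from injective, so it is replaced by a bijection `e` with `e i ≡ X i`. This exists
because the fibres over each class are infinite on both sides; `Respects` makes `e` an isomorphism.
-/
lemma pullback_mem_isoClass {L : FirstOrder.Language.{u, v}} [L.IsRelational] {N : Type w}
    [SN : (plus L).Structure N] [hF : (plus L).IsRelational] [Countable N]
    (heqv : Equivalence (Eqv L (N := N))) (hres : Respects L N)
    (hinf : ∀ a : N, (eqvClass L a).Infinite) {X : ℕ → N} (hX : ∀ a, {i | X i = a}.Infinite) :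
    pullback X ∈ isoClass (plus L) N := by
  let s : Setoid N := ⟨Eqv L, heqv⟩
  obtain ⟨e, he⟩ := exists_equiv_of_infinite_fibres (fun i => (⟦X i⟧ : Quotient s))
    (fun a => (⟦a⟧ : Quotient s))
    (by
      refine Quotient.ind fun a => ((hX a).mono fun i hi => ?_).to_subtype
      exact congrArg _ hi)
    (by
      refine Quotient.ind fun a => ((hinf a).mono fun b hb => ?_).to_subtype
      exact Quotient.sound (heqv.symm hb))
  have he' (i : ℕ) : Eqv L (e i) (X i) := Quotient.exact (he i)
  refine ⟨@FirstOrder.Language.Equiv.mk (plus L) ℕ N (pullback X) SN e (fun {n} f => (hF n).elim f) ?_⟩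
  rintro n (R | ⟨⟨⟩⟩) x
  · exact hres n R _ _ fun i => he' (x i)
  · obtain ⟨a, b, rfl⟩ : ∃ a b, x = ![a, b] :=
      ⟨x 0, x 1, by funext i; fin_cases i <;> rfl⟩
    change FirstOrder.Language.Structure.RelMap (eqvSym L) (e ∘ ![a, b]) ↔
      FirstOrder.Language.Structure.RelMap (eqvSym L) (X ∘ ![a, b])
    rw [comp_pair, comp_pair]
    exact ⟨fun h => heqv.trans (heqv.symm (he' a)) (heqv.trans h (he' b)),
      fun h => heqv.trans (he' a) (heqv.trans h (heqv.symm (he' b)))⟩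

/-- Counting measure is σ-finite here, and `toFinite` is a probability measure with the same null
sets. -/
lemma exists_isProbabilityMeasure_singleton_ne_zero (N : Type w) [Countable N] [Nonempty N]
    [MeasurableSpace N] [MeasurableSingletonClass N] :
    ∃ p : Measure N, IsProbabilityMeasure p ∧ ∀ a, p {a} ≠ 0 := by
  have : NeZero (Measure.count : Measure N) := ⟨Measure.count_ne_zero''⟩
  refine ⟨(Measure.count : Measure N).toFinite, inferInstance, fun a h => ?_⟩
  have := absolutelyContinuous_toFinite (Measure.count : Measure N) h
  simp at this

/-- An independent identically distributed sequence takes every value of positive probability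
infinitely often. -/
lemma ae_infinite_setOf_eq {N : Type w} [MeasurableSpace N] [MeasurableSingletonClass N]
    (p : Measure N) [IsProbabilityMeasure p] {a : N} (ha : p {a} ≠ 0) :
    ∀ᵐ X ∂(Measure.infinitePi fun _ : ℕ => p), {i | X i = a}.Infinite := by
  set P := Measure.infinitePi fun _ : ℕ => p
  let s : ℕ → Set (ℕ → N) := fun i => {X | X i = a}
  have hs (i : ℕ) : MeasurableSet (s i) :=
    (measurable_pi_apply (X := fun _ : ℕ => N) i) (measurableSet_singleton a)
  have hind : ProbabilityTheory.iIndepFun (fun (i : ℕ) (X : ℕ → N) => X i) P :=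
    ProbabilityTheory.iIndepFun_infinitePi (P := fun _ : ℕ => p) (X := fun _ x => x)
      (fun _ => measurable_id)
  have hset : ProbabilityTheory.iIndepSet s P := by
    rw [ProbabilityTheory.iIndepSet_iff_meas_biInter hs]
    intro t
    exact hind.measure_inter_preimage_eq_mul t (sets := fun _ => {a})
      fun _ _ => measurableSet_singleton a
  have hval (i : ℕ) : P (s i) = p {a} :=
    (measurePreserving_eval_infinitePi (fun _ : ℕ => p) i).measure_preimage
      (measurableSet_singleton a).nullMeasurableSet
  have hsum : ∑' i, P (s i) = ⊤ := by
    simp only [hval]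
    exact ENNReal.tsum_const_eq_top_of_ne_zero ha
  -- Second Borel–Cantelli lemma.
  have hone := ProbabilityTheory.measure_limsup_eq_one hs hset hsum
  have hae : ∀ᵐ X ∂P, X ∈ limsup s atTop :=
    (prob_compl_eq_zero_iff (MeasurableSet.measurableSet_limsup hs)).2 hone
  filter_upwards [hae] with X hX
  exact Nat.frequently_atTop_iff_infinite.1 ((mem_limsup_iff_frequently_mem (s := s)).1 hX)

lemma infinitePi_map_comp_perm {N : Type w} [MeasurableSpace N] (p : Measure N)
    [IsProbabilityMeasure p] (g : Equiv.Perm ℕ) :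
    (Measure.infinitePi fun _ : ℕ => p).map (fun X => X ∘ g) =
      Measure.infinitePi fun _ : ℕ => p := by
  -- Reindexing along `g.symm` is precomposition with `g`.
  have h := Measure.infinitePi_map_piCongrLeft (fun _ : ℕ => p) g.symm
  convert h using 2
  funext X i
  have := MeasurableEquiv.piCongrLeft_apply_apply g.symm (β := fun _ => N) X (g i)
  simpa using this.symm

theorem admitsInvariantMeasure_of_infinite_eqvClass {L : FirstOrder.Language.{u, v}} [L.IsRelational]
    {N : Type w} [SN : (plus L).Structure N] [Countable N] [Nonempty N]
    (heqv : Equivalence (Eqv L (N := N))) (hres : Respects L N)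
    (hinf : ∀ a : N, (eqvClass L a).Infinite) : AdmitsInvariantMeasure (plus L) N := by
  have hE : eqvLanguage.IsRelational := fun _ => inferInstanceAs (IsEmpty Empty)
  let _ : MeasurableSpace N := ⊤
  have : MeasurableSingletonClass N := ⟨fun _ => trivial⟩
  obtain ⟨p, _, hp⟩ := exists_isProbabilityMeasure_singleton_ne_zero N
  have hm : Measurable (pullback : (ℕ → N) → (plus L).Structure ℕ) := measurable_pullback
  refine ⟨(Measure.infinitePi fun _ : ℕ => p).map pullback,
    Measure.isProbabilityMeasure_map hm.aemeasurable, fun g A hA => ?_, ?_⟩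
  · have hpre : pullback ⁻¹' (logicAction g '' A) =
        (fun X : ℕ → N => X ∘ g) ⁻¹' (pullback ⁻¹' A) := by
      rw [image_logicAction]
      ext X
      simp only [Set.mem_preimage, logicAction_pullback, Equiv.symm_symm]
    have hg : Measurable fun X : ℕ → N => X ∘ g :=
      measurable_pi_lambda _ fun i => measurable_pi_apply (g i)
    have hgA : MeasurableSet (logicAction g '' A) := by
      rw [image_logicAction]
      exact measurable_logicAction g.symm hA
    rw [Measure.map_apply hm hgA, hpre, ← Measure.map_apply hg (hm hA), infinitePi_map_comp_perm,
      Measure.map_apply hm hA]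
  · have := Measure.isProbabilityMeasure_map (μ := Measure.infinitePi fun _ : ℕ => p)
      hm.aemeasurable
    -- `le_map_apply` holds for arbitrary sets, so `isoClass` need not be measurable.
    refine le_antisymm prob_le_one (le_trans ?_ (Measure.le_map_apply hm.aemeasurable _))
    have hae : ∀ᵐ X ∂(Measure.infinitePi fun _ : ℕ => p), ∀ a, {i | X i = a}.Infinite :=
      ae_all_iff.2 fun a => ae_infinite_setOf_eq p (hp a)
    have : ∀ᵐ X ∂(Measure.infinitePi fun _ : ℕ => p),
        X ∈ pullback ⁻¹' isoClass (plus L) N := by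
      filter_upwards [hae] with X hX
      exact pullback_mem_isoClass heqv hres hinf hX
    exact (measure_univ.symm.trans (measure_congr (eventuallyEq_univ.2 this)).symm).le

/-! ### Blow-ups -/

lemma equivalence_eqv_blowUp (L : FirstOrder.Language.{u, v}) [L.IsRelational] (M : Type w) [L.Structure M]
    (ι : Type) : Equivalence (Eqv L (N := BlowUp M ι)) :=
  ⟨fun _ => rfl, fun h => Eq.symm h, fun h h' => Eq.trans h h'⟩

lemma respects_blowUp (L : FirstOrder.Language.{u, v}) [L.IsRelational] (M : Type w) [L.Structure M]
    (ι : Type) : Respects L (BlowUp M ι) := by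
  intro k R x y h
  have : (fun i => (x i).1) = fun i => (y i).1 := funext h
  change FirstOrder.Language.Structure.RelMap R (fun i => (x i).1) ↔
    FirstOrder.Language.Structure.RelMap R (fun i => (y i).1)
  rw [this]

lemma eqvClass_blowUp (L : FirstOrder.Language.{u, v}) [L.IsRelational] {M : Type w} [L.Structure M]
    {ι : Type} (a : BlowUp M ι) : eqvClass L a = Set.range fun j : ι => ((a.1, j) : M × ι) := by
  ext ⟨b, j⟩
  constructor
  · rintro (h : a.1 = b)
    exact ⟨j, by rw [h]⟩
  · rintro ⟨j', h⟩
    have h' : a.1 = b := congrArg (Prod.fst : M × ι → M) h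
    exact h'

end InvariantMeasure

theorem mainTheorem11 (L : FirstOrder.Language.{u, v}) [L.IsRelational]
    [Countable L.Symbols] :
    (∀ (N : Type w) [(InvariantMeasure.plus L).Structure N] [Countable N] [Infinite N],
      Equivalence (InvariantMeasure.Eqv L (N := N)) →
      InvariantMeasure.Respects L N →
      (∀ a : N, (InvariantMeasure.eqvClass L a).Nontrivial) →
      ((∀ a : N, (InvariantMeasure.eqvClass L a).Infinite) ↔
        InvariantMeasure.AdmitsInvariantMeasure (InvariantMeasure.plus L) N)) ∧
    (∀ (M : Type w) [L.Structure M] [Countable M] [Infinite M],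
      InvariantMeasure.AdmitsInvariantMeasure (InvariantMeasure.plus L)
        (InvariantMeasure.BlowUp M ℕ) ∧
      ∀ n : ℕ, 1 < n →
        ¬ InvariantMeasure.AdmitsInvariantMeasure (InvariantMeasure.plus L)
          (InvariantMeasure.BlowUp M (Fin n))) := by
  refine ⟨fun N _ _ _ heqv hres hnt => ⟨fun hinf =>
    InvariantMeasure.admitsInvariantMeasure_of_infinite_eqvClass heqv hres hinf,
    fun h a ha => ?_⟩, fun M _ _ _ => ⟨?_, fun n hn => ?_⟩⟩
  · exact InvariantMeasure.not_admitsInvariantMeasure_of_finite_eqvClass hnt ha h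
  · have : Countable (InvariantMeasure.BlowUp M ℕ) := inferInstanceAs (Countable (M × ℕ))
    have : Nonempty (InvariantMeasure.BlowUp M ℕ) := inferInstanceAs (Nonempty (M × ℕ))
    refine InvariantMeasure.admitsInvariantMeasure_of_infinite_eqvClass
      (InvariantMeasure.equivalence_eqv_blowUp L M ℕ) (InvariantMeasure.respects_blowUp L M ℕ)
      fun a => ?_
    rw [InvariantMeasure.eqvClass_blowUp]
    exact Set.infinite_range_of_injective (Prod.mk_right_injective a.1)
  · have hinj (a : M) : Function.Injective fun j : Fin n => (a, j) := Prod.mk_right_injective a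
    have : Nontrivial (Fin n) := Fin.nontrivial_iff_two_le.2 hn
    obtain ⟨b⟩ : Nonempty (InvariantMeasure.BlowUp M (Fin n)) :=
      inferInstanceAs (Nonempty (M × Fin n))
    refine InvariantMeasure.not_admitsInvariantMeasure_of_finite_eqvClass (fun a => ?_) (a := b) ?_
    · rw [InvariantMeasure.eqvClass_blowUp]
      obtain ⟨i, j, hij⟩ := exists_pair_ne (Fin n)
      exact ⟨_, ⟨i, rfl⟩, _, ⟨j, rfl⟩, fun h => hij (hinj a.1 h)⟩
    · rw [InvariantMeasure.eqvClass_blowUp]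
      exact Set.finite_range _
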